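/- For each integer $n\ge 1$ divisible by $3$ make the following definitions. Let $e^1,e^2,e^3$ be the standard basis of $\mathbb R^3$, let $\Delta_{3,n}$ be the set of points $x\in[0,1]^3$ with $x_1+x_2+x_3=1$ all of whose coordinates are multiples of $1/n$, and let $E_{3,n}$ be the set of unordered pairs $\{x,y\}\subseteq\Delta_{3,n}$ with $\|x-y\|_1=2/n$. For $w:E_{3,n}\to\mathbb R_{\ge 0}$ put $$\mathrm{LP}(w)=\sum_{\{x,y\}\in E_{3,n}}w(x,y)\cdot\tfrac12\|x-y\|_1,\qquad \mathrm{cost}(P,w)=\sum_{\{x,y\}\in E_{3,n},\ P(x)\ne P(y)}w(x,y).$$ A non-opposite cut of $\Delta_{3,n}$ is a function $P:\Delta_{3,n}\to\{1,2,3,4\}$ with $P(e^i)=i$ for $i\in\{1,2,3\}$ and $P(x)\in\{i: x_i\neq 0\}\cup\{4\}$ for every $x\in\Delta_{3,n}$. Let $\rho=1/(2n)$, let $H=\{x\in\Delta_{3,n}: x_i\le 2/3 \text{ for all } i\}$ (the middle hexagon) and $T_i=\{x\in\Delta_{3,n}: x_i\ge 2/3\}$ (the corner triangles). Define $w:E_{3,n}\to\mathbb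 R_{\ge0}$ as follows. Every edge with both endpoints in $H$ has weight $\rho$. The remaining edges have both endpoints in exactly one $T_i$. Of these, those lying on one of the two sides of the big triangle that contain $e^i$ are weighted, on each of the two sides, in order of increasing distance from $e^i$, by $(n/3)\rho,\ (n/3-1)\rho,\ \dots,\ \rho$; those lying on no side of the big triangle have weight $0$ if they are parallel to the side opposite $e^i$ (that is, if their endpoints have the same $i$-th coordinate) and weight $\rho$ otherwise. Then there is an absolute constant $C$ such that for every $n\ge 1$ divisible by $3$ this weight function satisfies $$\mathrm{LP}(w)\le \frac56+\frac Cn,$$ and $\mathrm{cost}(P,w)\ge 1$ for every non-opposite cut $P$ of $\Delta_{3,n}$. -/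

import Mathlib

open scoped NNReal

/-- The point set `Δ_{k,n}` of the triangular grid: the points of the standard simplex in `ℝ^k` all
of whose coordinates are integer multiples of `1/n`. -/
def gridSet (k n : ℕ) : Set (Fin k → ℝ) :=
  {x | x ∈ stdSimplex ℝ (Fin k) ∧ ∀ i, ∃ m : ℤ, x i = (m : ℝ) / (n : ℝ)}

theorem gridSet_finite (k n : ℕ) : (gridSet k n).Finite := by
  have hfin : (Set.univ.pi fun _ : Fin k =>
      (fun m : ℤ => (m : ℝ) / (n : ℝ)) '' Set.Icc 0 (n : ℤ)).Finite :=
    Set.Finite.pi fun _ => (Set.finite_Icc _ _).image _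
  refine hfin.subset ?_
  rintro x ⟨hx, hm⟩ i -
  obtain ⟨m, hxm⟩ := hm i
  rcases Nat.eq_zero_or_pos n with rfl | hn
  · exact ⟨0, by simp, by simp [hxm]⟩
  · have hn' : (0 : ℝ) < n := by exact_mod_cast hn
    have h0 : 0 ≤ x i := hx.1 i
    have h1 : x i ≤ 1 := by
      rw [← hx.2]
      exact Finset.single_le_sum (fun j _ => hx.1 j) (Finset.mem_univ i)
    rw [hxm] at h0 h1
    have h0' : (0 : ℝ) ≤ m := by
      rcases div_nonneg_iff.1 h0 with h | h
      · exact h.1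
      · linarith [h.2]
    have h1' : (m : ℝ) ≤ n := by
      rwa [div_le_one hn'] at h1
    exact ⟨m, ⟨by exact_mod_cast h0', by exact_mod_cast h1'⟩, hxm.symm⟩

/-- The type of points of `Δ_{k,n}`. -/
abbrev Grid (k n : ℕ) : Type := {x : Fin k → ℝ // x ∈ gridSet k n}

noncomputable instance (k n : ℕ) : Fintype (Grid k n) := (gridSet_finite k n).fintype

/-- The `ℓ₁` distance `‖x - y‖₁` on `ℝ^k`. -/
noncomputable def l1Dist {k : ℕ} (x y : Fin k → ℝ) : ℝ := ∑ i, |x i - y i|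

theorem l1Dist_comm {k : ℕ} (x y : Fin k → ℝ) : l1Dist x y = l1Dist y x :=
  Finset.sum_congr rfl fun _ _ => abs_sub_comm _ _

/-- The undirected graph `(Δ_{k,n}, E_{k,n})`: two distinct points are adjacent
iff `‖x - y‖₁ = 2/n`. -/
def gridGraph (k n : ℕ) : SimpleGraph (Grid k n) where
  Adj x y := x ≠ y ∧ l1Dist x.1 y.1 = 2 / (n : ℝ)
  symm := ⟨fun x y h => ⟨h.1.symm, by rw [l1Dist_comm]; exact h.2⟩⟩
  loopless := ⟨fun _ h => h.1 rfl⟩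

/-- The set `E_{k,n}` of (unordered) edges. -/
abbrev GridEdge (k n : ℕ) : Type := {e : Sym2 (Grid k n) // e ∈ (gridGraph k n).edgeSet}

noncomputable instance (k n : ℕ) : Fintype (GridEdge k n) := Fintype.ofFinite _

/-- The `ℓ₁` length of an edge. -/
noncomputable def edgeLength {k n : ℕ} (e : Sym2 (Grid k n)) : ℝ :=
  Sym2.lift ⟨fun x y => l1Dist x.1 y.1, fun x y => l1Dist_comm x.1 y.1⟩ e

/-- The value of the canonical solution of the CKR relaxation (each point is mapped to itself):
`∑_{(x,y) ∈ E} w(x,y) · ½‖x - y‖₁`, each undirected edge being counted once. -/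
noncomputable def canonicalLP {k n : ℕ} (w : GridEdge k n → ℝ≥0) : ℝ :=
  ∑ e : GridEdge k n, (w e : ℝ) * (1 / 2 * edgeLength e.1)

/-- The edge `e` is cut by `P`: its endpoints lie in different clusters. -/
def IsCutBy {k n : ℕ} {L : Type} (P : Grid k n → L) (e : Sym2 (Grid k n)) : Prop :=
  ∃ x ∈ e, ∃ y ∈ e, P x ≠ P y

open Classical in
/-- The cost of a partition `P` with respect to `w`: the total weight of the edges that it cuts. -/
noncomputable def cutCost {k n : ℕ} {L : Type} (P : Grid k n → L) (w : GridEdge k n → ℝ≥0) : ℝ :=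
  ∑ e : GridEdge k n, if IsCutBy P e.1 then (w e : ℝ) else 0

/-- Non-opposite cuts of `Δ_{k,n}`. The clusters `1, …, k` are the elements `i.castSucc` of
`Fin (k + 1)` and the additional cluster `k + 1` is `Fin.last k`. -/
structure IsNonOppositeCut {k n : ℕ} (P : Grid k n → Fin (k + 1)) : Prop where
  /-- `P(e^i) = i` -/
  vertex : ∀ (i : Fin k) (x : Grid k n), x.1 = Pi.single i 1 → P x = i.castSucc
  /-- `P(x) ∈ supp(x) ∪ {k + 1}` -/
  support : ∀ x : Grid k n, (∃ i : Fin k, x.1 i ≠ 0 ∧ P x = i.castSucc) ∨ P x = Fin.last k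

/-- The edge lies in the middle hexagon `H`, the set of points with all coordinates `≤ 2/3`. -/
def InHexagon {n : ℕ} (e : Sym2 (Grid 3 n)) : Prop := ∀ x ∈ e, ∀ i, x.1 i ≤ 2 / 3

/-- The edge lies in the corner triangle `T_i`, the set of points with `x_i ≥ 2/3`. -/
def InCorner {n : ℕ} (i : Fin 3) (e : Sym2 (Grid 3 n)) : Prop := ∀ x ∈ e, 2 / 3 ≤ x.1 i

/-- The edge lies on one of the three sides of the whole triangle. -/
def OnBorder {n : ℕ} (e : Sym2 (Grid 3 n)) : Prop := ∃ j, ∀ x ∈ e, x.1 j = 0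

/-- The edge is parallel to the side of the triangle opposite to `e^i`. -/
def ParallelToOpposite {n : ℕ} (i : Fin 3) (e : Sym2 (Grid 3 n)) : Prop :=
  ∀ x ∈ e, ∀ y ∈ e, x.1 i = y.1 i

/-- The larger of the `i`-th coordinates of the endpoints of an edge. -/
noncomputable def maxCoord {n : ℕ} (i : Fin 3) (e : Sym2 (Grid 3 n)) : ℝ :=
  Sym2.lift ⟨fun x y => max (x.1 i) (y.1 i), fun x y => max_comm (x.1 i) (y.1 i)⟩ e

/-- The basic weight `ρ = 1/(2n)`. -/
noncomputable def gapRho (n : ℕ) : ℝ := 1 / (2 * (n : ℝ))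

open Classical in
/-- The weight of an edge lying in the corner triangle `T_i` and not in the hexagon.
On the two sides containing `e^i`, the edge closest to `e^i` has weight `(n/3)ρ`, the second closest
`(n/3 - 1)ρ`, and so on; `n * (1 - maxCoord i e)` is the number of edges of that side lying between
`e` and `e^i`. Off these sides, edges parallel to the side opposite to `e^i` have weight `0` and the
others have weight `ρ`. -/
noncomputable def cornerWeight (n : ℕ) (i : Fin 3) (e : Sym2 (Grid 3 n)) : ℝ :=
  if OnBorder e then ((n : ℝ) / 3 - (n : ℝ) * (1 - maxCoord i e)) * gapRho n
  else if ParallelToOpposite i e then 0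
  else gapRho n

open Classical in
/-- The explicit weights: `ρ` on the edges of the middle hexagon (including its border),
`cornerWeight` on the other edges of the corner triangles. -/
noncomputable def gapWeight (n : ℕ) (e : Sym2 (Grid 3 n)) : ℝ :=
  if InHexagon e then gapRho n
  else if InCorner 0 e then cornerWeight n 0 e
  else if InCorner 1 e then cornerWeight n 1 e
  else cornerWeight n 2 e

/-! Write n = 3m = N + 2 and scale coordinates by n. Every grid edge is an edge of exactly one
up-face u (a point of `tri (N + 1)`), so edges become pairs (u, direction). The faces, joined across
cut edges, form the dual graph `cutGraph`.

Topology: near the corner e^i, some component of the dual graph meets cut border edges on both sides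
at e^i (`exists_component`). This is a parity argument: along one of these sides the indicator of
label i changes an odd number of times, and it vanishes on the opposite side.

Metric: `potential m i` is 1-Lipschitz for the dual edge weights and equals the weight of the border
edge at a face on side i. Telescoping along a path shows that a component touching two sides weighs
at least 2m. A tripod of edge-disjoint paths shows that one touching all three weighs at least 6m.
If the three corner components are distinct, their weights add to 6m; if two coincide, that
component touches all three sides. As ρ = 1/(6m), the cost is at least 1 (`le_sum_cutEdges`).

The LP value is a count: the total weight is at most (15m² + 3m)ρ and each edge has half-length 1/n.
-/

/-! ### Lipschitz functions along paths and tripods in a graph. -/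

namespace SimpleGraph.Walk

variable {V : Type*} {G : SimpleGraph V}

/-- Telescoping: a function that is Lipschitz along edges varies along a walk by at most the total
weight of the walk. -/
theorem sub_le_sum_edges {wt : Sym2 V → ℤ} {f : V → ℤ}
    (hf : ∀ x y, G.Adj x y → f x - f y ≤ wt s(x, y)) {x y : V} (p : G.Walk x y) :
    f x - f y ≤ (p.edges.map wt).sum := by
  induction p with
  | nil => simp
  | cons h p ih =>
    have := hf _ _ h
    simp only [edges_cons, List.map_cons, List.sum_cons]
    linarith

theorem reachable_of_mem_edges {x y : V} (p : G.Walk x y) {e : Sym2 V} (he : e ∈ p.edges) {z : V}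
    (hz : z ∈ e) : G.Reachable x z := by
  classical
  have : z ∈ p.support := p.mem_support_of_mem_edges he hz
  exact ⟨p.takeUntil z this⟩

/-- A walk that ends in `S` can be cut where it first hits `S`. -/
theorem exists_first_hit (S : Set V) {x y : V} (p : G.Walk x y) (hy : y ∈ S) :
    ∃ z ∈ S, ∃ q : G.Walk x z, ∀ e ∈ q.edges, ∃ a ∈ e, a ∉ S := by
  induction p with
  | nil => exact ⟨_, hy, nil, by simp⟩
  | @cons a b c h p ih =>
    by_cases ha : a ∈ S
    · exact ⟨a, ha, nil, by simp⟩
    · obtain ⟨z, hz, q, hq⟩ := ih hy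
      refine ⟨z, hz, cons h q, ?_⟩
      intro e he
      rw [edges_cons, List.mem_cons] at he
      rcases he with rfl | he
      · exact ⟨a, by simp, ha⟩
      · exact hq e he

end SimpleGraph.Walk

namespace SimpleGraph

variable {V : Type*} {G : SimpleGraph V}

/-- The edges of a path joining two vertices weigh at least the variation of a Lipschitz function. -/
theorem Reachable.exists_edges_two {wt : Sym2 V → ℤ} {f : V → ℤ}
    (hf : ∀ x y, G.Adj x y → f x - f y ≤ wt s(x, y)) {x y : V} (h : G.Reachable x y) :
    ∃ T : Finset (Sym2 V), (∀ e ∈ T, e ∈ G.edgeSet ∧ ∀ z ∈ e, G.Reachable x z) ∧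
      f x - f y ≤ ∑ e ∈ T, wt e := by
  classical
  obtain ⟨p, hp⟩ := h.exists_isPath
  refine ⟨p.edges.toFinset, fun e he => ?_, ?_⟩
  · rw [List.mem_toFinset] at he
    exact ⟨p.edges_subset_edgeSet he, fun z hz => p.reachable_of_mem_edges he hz⟩
  · rw [List.sum_toFinset _ hp.isTrail.edges_nodup]
    exact p.sub_le_sum_edges hf

/-- Three vertices of a component are joined by edge-disjoint paths to a common vertex `p`. -/
theorem Reachable.exists_edges_three {wt : Sym2 V → ℤ} {f₁ f₂ f₃ : V → ℤ}
    (hf₁ : ∀ x y, G.Adj x y → f₁ x - f₁ y ≤ wt s(x, y))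
    (hf₂ : ∀ x y, G.Adj x y → f₂ x - f₂ y ≤ wt s(x, y))
    (hf₃ : ∀ x y, G.Adj x y → f₃ x - f₃ y ≤ wt s(x, y))
    {x y z : V} (hy : G.Reachable x y) (hz : G.Reachable x z) :
    ∃ p, G.Reachable x p ∧ ∃ T : Finset (Sym2 V),
      (∀ e ∈ T, e ∈ G.edgeSet ∧ ∀ a ∈ e, G.Reachable x a) ∧
      (f₁ p - f₁ x) + (f₂ p - f₂ y) + (f₃ p - f₃ z) ≤ ∑ e ∈ T, wt e := by
  classical
  obtain ⟨A, hA⟩ := hy.exists_isPath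
  obtain ⟨B⟩ := hz.symm
  -- The tripod has centre p, the first vertex of A met on the way from z. Before p every edge has
  -- an endpoint off A, so the third leg is edge-disjoint from A, and p splits A into the other two
  -- legs.
  obtain ⟨p, hp, q, hq⟩ := B.exists_first_hit {v | v ∈ A.support} A.start_mem_support
  have hp' : p ∈ A.support := hp
  have hq' : ∀ e ∈ q.bypass.edges, ∃ a ∈ e, a ∉ A.support := fun e he =>
    hq e (q.edges_bypass_subset_edges he)
  have hxp : G.Reachable x p := ⟨A.takeUntil p hp'⟩
  have hdisj : Disjoint A.edges.toFinset q.bypass.edges.toFinset := by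
    rw [Finset.disjoint_left]
    intro e h1 h2
    rw [List.mem_toFinset] at h1 h2
    obtain ⟨a, ha, hn⟩ := hq' e h2
    exact hn (A.mem_support_of_mem_edges h1 ha)
  refine ⟨p, hxp, A.edges.toFinset ∪ q.bypass.edges.toFinset, ?_, ?_⟩
  · intro e he
    rw [Finset.mem_union, List.mem_toFinset, List.mem_toFinset] at he
    rcases he with he | he
    · exact ⟨A.edges_subset_edgeSet he, fun a ha => A.reachable_of_mem_edges he ha⟩
    · exact ⟨q.bypass.edges_subset_edgeSet he,
        fun a ha => hz.trans (q.bypass.reachable_of_mem_edges he ha)⟩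
  · rw [Finset.sum_union hdisj, List.sum_toFinset _ hA.isTrail.edges_nodup,
      List.sum_toFinset _ (q.bypass_isPath).isTrail.edges_nodup]
    have h1 := (A.takeUntil p hp').reverse.sub_le_sum_edges hf₁
    have h2 := (A.dropUntil p hp').sub_le_sum_edges hf₂
    have h3 := q.bypass.reverse.sub_le_sum_edges hf₃
    have hsplit : (A.edges.map wt).sum =
        ((A.takeUntil p hp').edges.map wt).sum + ((A.dropUntil p hp').edges.map wt).sum := by
      conv_lhs => rw [← A.take_spec hp']
      rw [Walk.edges_append, List.map_append, List.sum_append]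
    simp only [Walk.edges_reverse, List.map_reverse, List.sum_reverse] at h1 h3
    linarith

end SimpleGraph

/-! ### The integer grid, its faces, and the dual graph of cut edges. -/

namespace TriGrid

open Finset

/-- The unit vector `e^i` of the integer grid. -/
def unit (i : Fin 3) : Fin 3 → ℕ := Pi.single i 1

/-- The integer points of the triangle of side `s`. -/
def tri (s : ℕ) : Finset (Fin 3 → ℕ) := Finset.Nat.antidiagonalTuple 3 s

theorem mem_tri {s : ℕ} {x : Fin 3 → ℕ} : x ∈ tri s ↔ x 0 + x 1 + x 2 = s := by
  rw [tri, Finset.Nat.mem_antidiagonalTuple, Fin.sum_univ_three]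

theorem unit_apply (i j : Fin 3) : unit i j = if j = i then 1 else 0 := by
  simp [unit, Pi.single_apply]

theorem add_unit_mem_tri {s : ℕ} {x : Fin 3 → ℕ} (hx : x ∈ tri s) (i : Fin 3) :
    x + unit i ∈ tri (s + 1) := by
  rw [mem_tri] at *
  fin_cases i <;> simp [unit_apply] <;> omega

theorem mem_tri_of_add_unit {s : ℕ} {x : Fin 3 → ℕ} {i : Fin 3} (hx : x + unit i ∈ tri (s + 1)) :
    x ∈ tri s := by
  rw [mem_tri] at *
  fin_cases i <;> simp [unit_apply] at hx <;> omega

theorem eq_add_unit {x : Fin 3 → ℕ} {i : Fin 3} (h : x i ≠ 0) : ∃ d, x = d + unit i := by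
  refine ⟨x - unit i, ?_⟩
  funext j
  simp only [Pi.add_apply, Pi.sub_apply, unit_apply]
  split_ifs with hj
  · subst hj; omega
  · omega

/-- The up-face `u` has corners `u + e^j`; its edge in direction `i` is the one opposite to
`u + e^i`. It is cut by the labelling `Q` if its endpoints have different labels. -/
def EdgeCut {L : Type*} (Q : (Fin 3 → ℕ) → L) (u : Fin 3 → ℕ) (i : Fin 3) : Prop :=
  Q (u + unit (i + 1)) ≠ Q (u + unit (i + 2))

/-- The dual graph on the faces of the triangle of side `N + 2`, up-faces being the points of
`tri (N + 1)` and down-faces those of `tri N`: two faces are adjacent if they share a cut edge. -/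
def cutGraph {L : Type*} (N : ℕ) (Q : (Fin 3 → ℕ) → L) : SimpleGraph (Fin 3 → ℕ) :=
  SimpleGraph.fromRel fun d u => ∃ i, d ∈ tri N ∧ u = d + unit i ∧ EdgeCut Q u i

section

variable {L : Type*} {N : ℕ} {Q : (Fin 3 → ℕ) → L}

theorem cutGraph_adj_add_unit {d : Fin 3 → ℕ} {i : Fin 3} (hd : d ∈ tri N)
    (h : EdgeCut Q (d + unit i) i) : (cutGraph N Q).Adj (d + unit i) d := by
  refine ⟨fun h => ?_, Or.inr ⟨i, hd, rfl, h⟩⟩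
  have := congrFun h i
  simp [unit_apply] at this

theorem cutGraph_adj_iff {x y : Fin 3 → ℕ} : (cutGraph N Q).Adj x y ↔
    (∃ i, x ∈ tri N ∧ y = x + unit i ∧ EdgeCut Q y i) ∨
      ∃ i, y ∈ tri N ∧ x = y + unit i ∧ EdgeCut Q x i := by
  constructor
  · exact fun h => h.2
  · rintro (⟨i, hd, rfl, h⟩ | ⟨i, hd, rfl, h⟩)
    · exact (cutGraph_adj_add_unit hd h).symm
    · exact cutGraph_adj_add_unit hd h

theorem mem_tri_of_reachable {x y : Fin 3 → ℕ} (h : (cutGraph N Q).Reachable x y)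
    (hx : x ∈ tri N ∨ x ∈ tri (N + 1)) : y ∈ tri N ∨ y ∈ tri (N + 1) := by
  obtain ⟨p⟩ := h
  induction p with
  | nil => exact hx
  | cons h p ih =>
    apply ih
    rcases cutGraph_adj_iff.1 h with ⟨i, hd, rfl, -⟩ | ⟨i, hd, rfl, -⟩
    · exact Or.inr (add_unit_mem_tri hd i)
    · exact Or.inl hd

end

/-- Sums over pairs (up-face, direction) with an interior edge, reindexed by down-faces. -/
theorem sum_interior {M : Type*} [AddCommMonoid M] (N : ℕ) (F : (Fin 3 → ℕ) → M) (i : Fin 3) :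
    ∑ u ∈ tri (N + 1) with u i ≠ 0, F u = ∑ d ∈ tri N, F (d + unit i) := by
  symm
  refine Finset.sum_bij (fun d _ => d + unit i) ?_ ?_ ?_ ?_
  · intro d hd
    simp [add_unit_mem_tri hd i, unit_apply]
  · intro a _ b _ h
    exact add_right_cancel h
  · intro u hu
    rw [mem_filter] at hu
    obtain ⟨d, rfl⟩ := eq_add_unit hu.2
    exact ⟨d, mem_tri_of_add_unit hu.1, rfl⟩
  · intros; rfl

/-- Sums over the up-faces along the side `i + 1`. -/
theorem sum_side {M : Type*} [AddCommMonoid M] (N : ℕ) (F : (Fin 3 → ℕ) → M) (i : Fin 3) :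
    ∑ u ∈ tri (N + 1) with u (i + 1) = 0, F u =
      ∑ a ∈ range (N + 2), F (Pi.single i a + Pi.single (i + 2) (N + 1 - a)) := by
  symm
  refine Finset.sum_bij (fun a _ => Pi.single i a + Pi.single (i + 2) (N + 1 - a)) ?_ ?_ ?_ ?_
  · intro a ha
    rw [mem_range] at ha
    rw [mem_filter, mem_tri]
    fin_cases i <;> simp <;> omega
  · intro a _ b _ h
    have := congrFun h i
    fin_cases i <;> simpa [Pi.single_apply] using this
  · intro u hu
    rw [mem_filter, mem_tri] at hu
    refine ⟨u i, ?_, ?_⟩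
    · rw [mem_range]; fin_cases i <;> simp at hu ⊢ <;> omega
    · funext j
      obtain ⟨h1, h2⟩ := hu
      fin_cases i <;> fin_cases j <;> simp at h1 h2 ⊢ <;> omega
  · intros; rfl

/-! ### Parity: the cut separates each corner. -/

/-- Both border sides at the corner `i` are reached by one component of the cut. -/
theorem exists_component {N : ℕ} {Q : (Fin 3 → ℕ) → Fin 4}
    (hv : ∀ i : Fin 3, Q (Pi.single i (N + 2)) = i.castSucc)
    (hs : ∀ (i : Fin 3) (x), x ∈ tri (N + 2) → x i = 0 → Q x ≠ i.castSucc) (i : Fin 3) :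
    ∃ u ∈ tri (N + 1), ∃ v ∈ tri (N + 1), u (i + 1) = 0 ∧ v (i + 2) = 0 ∧
      EdgeCut Q u (i + 1) ∧ EdgeCut Q v (i + 2) ∧ (cutGraph N Q).Reachable u v := by
  classical
  by_contra hcon
  push Not at hcon
  -- χ indicates label i and δ is its coboundary mod 2, so δ sums to zero around every face, up or
  -- down.
  let χ : (Fin 3 → ℕ) → ZMod 2 := fun x => if Q x = i.castSucc then 1 else 0
  let δ : (Fin 3 → ℕ) → Fin 3 → ZMod 2 := fun u l => χ (u + unit (l + 1)) + χ (u + unit (l + 2))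
  have hδ : ∀ u l, δ u l ≠ 0 → EdgeCut Q u l := by
    intro u l h h'
    apply h
    simp only [δ, χ, h']
    exact CharTwo.add_self_eq_zero _
  -- R consists of the faces reached from cut edges of side i + 1. By assumption it meets no cut
  -- edge of side i + 2.
  let R : Set (Fin 3 → ℕ) := {x | ∃ u ∈ tri (N + 1), u (i + 1) = 0 ∧ EdgeCut Q u (i + 1) ∧
    (cutGraph N Q).Reachable u x}
  let r : (Fin 3 → ℕ) → ZMod 2 := fun x => if x ∈ R then 1 else 0
  have hup : ∀ u, ∑ l, δ u l = 0 := by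
    intro u
    simp only [Fin.sum_univ_three, δ, Fin.isValue]
    have e1 : (1 : Fin 3) + 2 = 0 := rfl
    have e2 : (2 : Fin 3) + 2 = 1 := rfl
    have e3 : (2 : Fin 3) + 1 = 0 := rfl
    have e4 : (1 : Fin 3) + 1 = 2 := rfl
    simp only [e1, e2, e3, e4, zero_add]
    have h0 := CharTwo.add_self_eq_zero (χ (u + unit 0))
    have h1 := CharTwo.add_self_eq_zero (χ (u + unit 1))
    have h2 := CharTwo.add_self_eq_zero (χ (u + unit 2))
    linear_combination h0 + h1 + h2
  have hdown : ∀ d, ∑ l, δ (d + unit l) l = 0 := by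
    intro u
    simp only [Fin.sum_univ_three, δ, Fin.isValue]
    have e1 : (1 : Fin 3) + 2 = 0 := rfl
    have e2 : (2 : Fin 3) + 2 = 1 := rfl
    have e3 : (2 : Fin 3) + 1 = 0 := rfl
    have e4 : (1 : Fin 3) + 1 = 2 := rfl
    simp only [e1, e2, e3, e4, zero_add]
    rw [add_right_comm u (unit 1) (unit 0), add_right_comm u (unit 2) (unit 0),
      add_right_comm u (unit 2) (unit 1)]
    have h0 := CharTwo.add_self_eq_zero (χ (u + unit 0 + unit 1))
    have h1 := CharTwo.add_self_eq_zero (χ (u + unit 0 + unit 2))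
    have h2 := CharTwo.add_self_eq_zero (χ (u + unit 1 + unit 2))
    linear_combination h0 + h1 + h2
  -- Where δ is nonzero the edge is cut, so its two faces are both in R or both outside. Interior
  -- contributions can thus be regrouped by down-faces, where they vanish, leaving only the border.
  have hr : ∀ d ∈ tri N, ∀ l, r (d + unit l) * δ (d + unit l) l = r d * δ (d + unit l) l := by
    intro d hd l
    by_cases h : δ (d + unit l) l = 0
    · simp [h]
    · have hadj := (cutGraph_adj_add_unit hd (hδ _ _ h)).reachable
      have : d + unit l ∈ R ↔ d ∈ R := by
        constructor
        · rintro ⟨u, hu, h1, h2, h3⟩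
          exact ⟨u, hu, h1, h2, h3.trans hadj⟩
        · rintro ⟨u, hu, h1, h2, h3⟩
          exact ⟨u, hu, h1, h2, h3.trans hadj.symm⟩
      simp only [r, this]
  have htot : ∑ l, ∑ u ∈ tri (N + 1), r u * δ u l = 0 := by
    rw [Finset.sum_comm]
    refine Finset.sum_eq_zero fun u _ => ?_
    rw [← Finset.mul_sum, hup, mul_zero]
  have hint : ∑ l, ∑ u ∈ tri (N + 1) with u l ≠ 0, r u * δ u l = 0 := by
    simp_rw [sum_interior N (fun u => r u * δ u _)]
    rw [Finset.sum_comm]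
    refine Finset.sum_eq_zero fun d hd => ?_
    rw [Finset.sum_congr rfl fun l _ => hr d hd l, ← Finset.mul_sum, hdown, mul_zero]
  have hbord : ∑ l, ∑ u ∈ tri (N + 1) with u l = 0, r u * δ u l = 0 := by
    rw [← htot, ← add_zero (∑ l, _), ← hint, ← Finset.sum_add_distrib]
    exact Finset.sum_congr rfl fun l _ =>
      Finset.sum_filter_add_sum_filter_not (tri (N + 1)) (fun u => u l = 0) _
  have hi : ∑ u ∈ tri (N + 1) with u i = 0, r u * δ u i = 0 := by
    refine Finset.sum_eq_zero fun u hu => ?_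
    rw [mem_filter] at hu
    have h0 : ∀ l, i ≠ l → χ (u + unit l) = 0 := by
      intro l hl
      simp only [χ]
      rw [if_neg]
      apply hs i _ (add_unit_mem_tri hu.1 l)
      simp [hu.2, unit_apply, hl]
    simp only [δ]
    rw [h0 _ (by fin_cases i <;> decide), h0 _ (by fin_cases i <;> decide)]
    simp
  have hk : ∑ u ∈ tri (N + 1) with u (i + 2) = 0, r u * δ u (i + 2) = 0 := by
    refine Finset.sum_eq_zero fun v hv => ?_
    rw [mem_filter] at hv
    by_cases h : δ v (i + 2) = 0
    · simp [h]
    · have : v ∉ R := by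
        rintro ⟨u, hu, h1, h2, h3⟩
        exact hcon u hu v hv.1 h1 hv.2 h2 (hδ _ _ h) h3
      simp [r, this]
  have hj : ∑ u ∈ tri (N + 1) with u (i + 1) = 0, r u * δ u (i + 1) = 1 := by
    have : ∀ u ∈ (tri (N + 1)).filter (fun u => u (i + 1) = 0),
        r u * δ u (i + 1) = δ u (i + 1) := by
      intro u hu
      rw [mem_filter] at hu
      by_cases h : δ u (i + 1) = 0
      · simp [h]
      · have : u ∈ R := ⟨u, hu.1, hu.2, hδ _ _ h, SimpleGraph.Reachable.refl _⟩
        simp [r, this]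
    rw [Finset.sum_congr rfl this, sum_side]
    -- The values of χ along side i + 1, ending at e^i. The border sum telescopes to the difference
    -- of its end values, which is 1.
    let c : ℕ → ZMod 2 := fun a => χ (Pi.single i a + Pi.single (i + 2) (N + 2 - a))
    have hc : ∀ a ∈ range (N + 2),
        δ (Pi.single i a + Pi.single (i + 2) (N + 1 - a)) (i + 1) = c (a + 1) - c a := by
      intro a ha
      rw [mem_range] at ha
      rw [CharTwo.sub_eq_add]
      simp only [δ, c]
      rw [add_comm]
      congr 2
      · funext j
        fin_cases i <;> fin_cases j <;> simp [unit_apply]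
      · funext j
        fin_cases i <;> fin_cases j <;> simp [unit_apply] <;> omega
    rw [Finset.sum_congr rfl hc, Finset.sum_range_sub]
    have h1 : c (N + 2) = 1 := by
      simp [c, χ, hv]
    have h2 : c 0 = 0 := by
      simp only [c, χ, Nat.sub_zero, Pi.single_zero, zero_add, hv]
      rw [if_neg]
      fin_cases i <;> decide
    rw [h1, h2, sub_zero]
  have hsum : ∀ F : Fin 3 → ZMod 2, ∑ l, F l = F i + F (i + 1) + F (i + 2) := by
    intro F
    rw [Fin.sum_univ_three]
    fin_cases i
    · rfl
    · change F 0 + F 1 + F 2 = F 1 + F 2 + F 0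
      ring
    · change F 0 + F 1 + F 2 = F 2 + F 0 + F 1
      ring
  rw [hsum, hi, hj, hk] at hbord
  exact absurd hbord (by decide)

/-! ### Edge weights and potentials. -/

/-- The weight, in units of `ρ`, of the edge of the up-face `u` in direction `i`, in the triangle
of side `3 * m`. -/
def weight (m : ℕ) (u : Fin 3 → ℕ) (i : Fin 3) : ℤ :=
  if 2 * m < u i then 0
  else if u i = 0 then 1 + ((u (i + 1) - 2 * m : ℕ) : ℤ) + ((u (i + 2) - 2 * m : ℕ) : ℤ)
  else 1

/-- The weight, in units of `ρ`, of the dual edge joining two faces. -/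
def dualWeight (m : ℕ) (e : Sym2 (Fin 3 → ℕ)) : ℤ :=
  Sym2.lift ⟨fun x y => 1 - ∑ l, |((x l - 2 * m : ℕ) : ℤ) - ((y l - 2 * m : ℕ) : ℤ)|,
    fun _ _ => by simp only [abs_sub_comm]⟩ e

/-- A lower bound for the weighted dual distance from the face `x` to the side `i`. -/
def potential (m : ℕ) (i : Fin 3) (x : Fin 3 → ℕ) : ℤ :=
  2 * x i + (3 * m - ∑ j, (x j : ℤ)) + ∑ j, ((x j - 2 * m : ℕ) : ℤ) - 2 * ((x i - 2 * m : ℕ) : ℤ)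

theorem weight_nonneg (m : ℕ) (u : Fin 3 → ℕ) (i : Fin 3) : 0 ≤ weight m u i := by
  unfold weight
  split_ifs <;> omega

theorem dualWeight_add_unit (m : ℕ) (d : Fin 3 → ℕ) (i : Fin 3) :
    dualWeight m s(d + unit i, d) = weight m (d + unit i) i := by
  have h : ∀ a : ℕ, (1 : ℤ) - |((a + 1 - 2 * m : ℕ) : ℤ) - ((a - 2 * m : ℕ) : ℤ)| =
      if 2 * m < a + 1 then 0 else 1 := by
    intro a
    split_ifs with h
    · rw [abs_of_nonneg] <;> omega
    · rw [abs_of_nonneg] <;> omega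
  have h' := h (d i)
  fin_cases i <;> simp [dualWeight, weight, unit_apply, Fin.sum_univ_three] at h' ⊢ <;> exact h'

/-- Passing between d and d + e^i changes the untruncated part of the potential by ±1. When d i ≥ 2m
the truncated terms cancel this change exactly, which is where the edge has weight 0. -/
theorem abs_potential_sub_le (m : ℕ) (d : Fin 3 → ℕ) (i j : Fin 3) :
    |potential m j (d + unit i) - potential m j d| ≤ weight m (d + unit i) i := by
  have h : weight m (d + unit i) i = if 2 * m < d i + 1 then 0 else 1 := by
    simp [weight, unit_apply]
  rw [h, abs_le]
  fin_cases i <;> fin_cases j <;> simp [potential, unit_apply, Fin.sum_univ_three] <;>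
    split_ifs <;> omega

theorem potential_sub_le_of_adj {L : Type*} {N : ℕ} {Q : (Fin 3 → ℕ) → L} (m : ℕ) (j : Fin 3)
    (x y : Fin 3 → ℕ) (h : (cutGraph N Q).Adj x y) :
    potential m j x - potential m j y ≤ dualWeight m s(x, y) := by
  rcases cutGraph_adj_iff.1 h with ⟨i, -, rfl, -⟩ | ⟨i, -, rfl, -⟩
  · rw [Sym2.eq_swap, dualWeight_add_unit]
    have := abs_le.1 (abs_potential_sub_le m x i j)
    linarith [this.1]
  · rw [dualWeight_add_unit]
    exact (abs_le.1 (abs_potential_sub_le m y i j)).2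

/-- On an up-face `3 * m - ∑ j, x j` equals 1, so with u i = 0 only 1 and the two truncated excesses
remain. This lets border edges close the telescoping sums. -/
theorem potential_eq_weight {m N : ℕ} (hN : N + 2 = 3 * m) {u : Fin 3 → ℕ} (hu : u ∈ tri (N + 1))
    {i : Fin 3} (hi : u i = 0) : potential m i u = weight m u i := by
  rw [mem_tri] at hu
  unfold weight potential
  fin_cases i <;> simp [Fin.sum_univ_three] at hi ⊢ <;> simp [hi] at hu ⊢ <;> omega

/-- The sum equals 9m - ∑ x j + ∑ (x j - 2m)⁺, and ∑ x j < 3m on faces. -/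
theorem le_sum_potential {m N : ℕ} (hN : N + 2 = 3 * m) {x : Fin 3 → ℕ}
    (hx : x ∈ tri N ∨ x ∈ tri (N + 1)) :
    6 * m ≤ potential m 0 x + potential m 1 x + potential m 2 x := by
  rw [mem_tri, mem_tri] at hx
  simp only [potential, Fin.sum_univ_three]
  omega

/-- With k the third index, the sum equals 6m - 2 min(x k, 2m). -/
theorem le_add_potential {m N : ℕ} (hN : N + 2 = 3 * m) {x : Fin 3 → ℕ}
    (hx : x ∈ tri N ∨ x ∈ tri (N + 1)) {i j : Fin 3} (hij : i ≠ j) :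
    2 * m ≤ potential m i x + potential m j x := by
  rw [mem_tri, mem_tri] at hx
  fin_cases i <;> fin_cases j <;> simp at hij <;> simp [potential, Fin.sum_univ_three] <;> omega

/-! ### Lower bounds for the weight of a cut. -/

open Classical in
/-- The (up-face, direction) pairs that represent cut edges dual to faces in `R`. -/
noncomputable def cutEdges {L : Type*} (N : ℕ) (Q : (Fin 3 → ℕ) → L) (R : Set (Fin 3 → ℕ)) :
    Finset ((Fin 3 → ℕ) × Fin 3) :=
  (tri (N + 1) ×ˢ univ).filter fun b => EdgeCut Q b.1 b.2 ∧ b.1 ∈ R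

section

variable {L : Type*} {N : ℕ} {Q : (Fin 3 → ℕ) → L}

theorem mem_cutEdges {R : Set (Fin 3 → ℕ)} {b : (Fin 3 → ℕ) × Fin 3} :
    b ∈ cutEdges N Q R ↔ b.1 ∈ tri (N + 1) ∧ EdgeCut Q b.1 b.2 ∧ b.1 ∈ R := by
  simp [cutEdges]

/-- A set of dual edges inside `R` together with border edges at `R` weighs at most as much as
all cut edges at `R`. -/
theorem sum_add_sum_le (m : ℕ) {R : Set (Fin 3 → ℕ)} {T : Finset (Sym2 (Fin 3 → ℕ))}
    (hT : ∀ e ∈ T, e ∈ (cutGraph N Q).edgeSet ∧ ∀ x ∈ e, x ∈ R)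
    {B : Finset ((Fin 3 → ℕ) × Fin 3)} (hB : ∀ b ∈ B, b ∈ cutEdges N Q R ∧ b.1 b.2 = 0) :
    ∑ e ∈ T, dualWeight m e + ∑ b ∈ B, weight m b.1 b.2 ≤
      ∑ b ∈ cutEdges N Q R, weight m b.1 b.2 := by
  classical
  -- A dual edge crosses an interior edge, represented by its up-face with nonzero coordinate in
  -- that direction; border pairs have coordinate 0, hence no double counting.
  have key : ∀ e ∈ T, ∃ b : (Fin 3 → ℕ) × Fin 3,
      b ∈ cutEdges N Q R ∧ b.1 b.2 ≠ 0 ∧ e = s(b.1, b.1 - unit b.2) ∧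
        dualWeight m e = weight m b.1 b.2 := by
    intro e he
    obtain ⟨h1, h2⟩ := hT e he
    induction e with
    | h x y =>
      rw [SimpleGraph.mem_edgeSet, cutGraph_adj_iff] at h1
      rcases h1 with ⟨i, hd, rfl, hc⟩ | ⟨i, hd, rfl, hc⟩
      · refine ⟨(x + unit i, i), ?_, ?_, ?_, ?_⟩
        · exact mem_cutEdges.2 ⟨add_unit_mem_tri hd i, hc, h2 _ (by simp)⟩
        · simp [unit_apply]
        · simp [Sym2.eq_swap]
        · rw [Sym2.eq_swap, dualWeight_add_unit]
      · refine ⟨(y + unit i, i), ?_, ?_, ?_, ?_⟩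
        · exact mem_cutEdges.2 ⟨add_unit_mem_tri hd i, hc, h2 _ (by simp)⟩
        · simp [unit_apply]
        · simp
        · rw [dualWeight_add_unit]
  choose! g hg1 hg2 hg3 hg4 using key
  have hinj : Set.InjOn g T := by
    intro e he e' he' h
    rw [hg3 e he, hg3 e' he', h]
  have hT' : ∑ e ∈ T, dualWeight m e = ∑ b ∈ T.image g, weight m b.1 b.2 := by
    rw [Finset.sum_image hinj]
    exact Finset.sum_congr rfl hg4
  have hdisj : Disjoint (T.image g) B := by
    rw [Finset.disjoint_left]
    intro b hb hb'
    rw [mem_image] at hb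
    obtain ⟨e, he, rfl⟩ := hb
    exact hg2 e he (hB _ hb').2
  rw [hT', ← Finset.sum_union hdisj]
  refine Finset.sum_le_sum_of_subset_of_nonneg ?_ fun b _ _ => weight_nonneg _ _ _
  intro b hb
  rw [mem_union, mem_image] at hb
  rcases hb with ⟨e, he, rfl⟩ | hb
  · exact hg1 e he
  · exact (hB b hb).1

/-- The cut reaches the side `i` inside the component of `r`. -/
def Touches (N : ℕ) (Q : (Fin 3 → ℕ) → L) (r : Fin 3 → ℕ) (i : Fin 3) : Prop :=
  ∃ u ∈ tri (N + 1), u i = 0 ∧ EdgeCut Q u i ∧ (cutGraph N Q).Reachable r u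

/-- The path from u to v pays at least the drop of `potential m j`; adding the two border weights
leaves the sum of both potentials at u. -/
theorem le_sum_of_touches_two {m : ℕ} (hN : N + 2 = 3 * m) {r : Fin 3 → ℕ} {i j : Fin 3}
    (hij : i ≠ j) (hi : Touches N Q r i) (hj : Touches N Q r j) :
    2 * (m : ℤ) ≤ ∑ b ∈ cutEdges N Q {x | (cutGraph N Q).Reachable r x}, weight m b.1 b.2 := by
  classical
  obtain ⟨u, hu, hui, huc, hur⟩ := hi
  obtain ⟨v, hv, hvj, hvc, hvr⟩ := hj
  obtain ⟨T, hT, hle⟩ := SimpleGraph.Reachable.exists_edges_two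
    (potential_sub_le_of_adj (N := N) (Q := Q) m j) (hur.symm.trans hvr)
  have hne : (u, i) ≠ (v, j) := fun h => hij (congrArg Prod.snd h)
  have hsum := sum_add_sum_le (N := N) (Q := Q) m (T := T)
    (R := {x | (cutGraph N Q).Reachable r x}) (B := {(u, i), (v, j)})
    (fun e he => ⟨(hT e he).1, fun x hx => hur.trans ((hT e he).2 x hx)⟩) (by
      intro b hb
      rw [mem_insert, mem_singleton] at hb
      rcases hb with rfl | rfl
      · exact ⟨mem_cutEdges.2 ⟨hu, huc, hur⟩, hui⟩
      · exact ⟨mem_cutEdges.2 ⟨hv, hvc, hvr⟩, hvj⟩)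
  rw [Finset.sum_pair hne] at hsum
  have h1 := le_add_potential hN (Or.inr hu) hij
  have h2 := potential_eq_weight hN hu hui
  have h3 := potential_eq_weight hN hv hvj
  linarith

/-- With the border weights added, each leg of the tripod pays the potential of its side at the
centre p. -/
theorem le_sum_of_touches_three {m : ℕ} (hN : N + 2 = 3 * m) {r : Fin 3 → ℕ}
    (h : ∀ i, Touches N Q r i) :
    6 * (m : ℤ) ≤ ∑ b ∈ cutEdges N Q {x | (cutGraph N Q).Reachable r x}, weight m b.1 b.2 := by
  classical
  obtain ⟨u, hu, hui, huc, hur⟩ := h 0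
  obtain ⟨v, hv, hvj, hvc, hvr⟩ := h 1
  obtain ⟨w, hw, hwk, hwc, hwr⟩ := h 2
  obtain ⟨p, hp, T, hT, hle⟩ := SimpleGraph.Reachable.exists_edges_three
    (potential_sub_le_of_adj (N := N) (Q := Q) m 0)
    (potential_sub_le_of_adj (N := N) (Q := Q) m 1)
    (potential_sub_le_of_adj (N := N) (Q := Q) m 2)
    (hur.symm.trans hvr) (hur.symm.trans hwr)
  have hsum := sum_add_sum_le (N := N) (Q := Q) m (T := T)
    (R := {x | (cutGraph N Q).Reachable r x}) (B := {(u, 0), (v, 1), (w, 2)})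
    (fun e he => ⟨(hT e he).1, fun x hx => hur.trans ((hT e he).2 x hx)⟩) (by
      intro b hb
      simp only [mem_insert, mem_singleton] at hb
      rcases hb with rfl | rfl | rfl
      · exact ⟨mem_cutEdges.2 ⟨hu, huc, hur⟩, hui⟩
      · exact ⟨mem_cutEdges.2 ⟨hv, hvc, hvr⟩, hvj⟩
      · exact ⟨mem_cutEdges.2 ⟨hw, hwc, hwr⟩, hwk⟩)
  rw [Finset.sum_insert (by simp), Finset.sum_pair (by simp)] at hsum
  have h1 := le_sum_potential hN (mem_tri_of_reachable hp (Or.inr hu))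
  have h2 := potential_eq_weight hN hu hui
  have h3 := potential_eq_weight hN hv hvj
  have h4 := potential_eq_weight hN hw hwk
  linarith

theorem cutEdges_disjoint {r s : Fin 3 → ℕ} (h : ¬ (cutGraph N Q).Reachable r s) :
    Disjoint (cutEdges N Q {x | (cutGraph N Q).Reachable r x})
      (cutEdges N Q {x | (cutGraph N Q).Reachable s x}) := by
  rw [Finset.disjoint_left]
  intro b h1 h2
  exact h ((mem_cutEdges.1 h1).2.2.trans (mem_cutEdges.1 h2).2.2.symm)

theorem sum_cutEdges_le (m : ℕ) (S : Finset ((Fin 3 → ℕ) × Fin 3))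
    (hS : ∀ b ∈ S, b ∈ cutEdges N Q Set.univ) :
    ∑ b ∈ S, weight m b.1 b.2 ≤ ∑ b ∈ cutEdges N Q Set.univ, weight m b.1 b.2 :=
  Finset.sum_le_sum_of_subset_of_nonneg hS fun _ _ _ => weight_nonneg _ _ _

end

/-- A non-opposite cut of the integer grid of side `3 * m` weighs at least `6 * m` units. -/
theorem le_sum_cutEdges {m N : ℕ} (hN : N + 2 = 3 * m) {Q : (Fin 3 → ℕ) → Fin 4}
    (hv : ∀ i : Fin 3, Q (Pi.single i (N + 2)) = i.castSucc)
    (hs : ∀ (i : Fin 3) (x), x ∈ tri (N + 2) → x i = 0 → Q x ≠ i.castSucc) :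
    6 * (m : ℤ) ≤ ∑ b ∈ cutEdges N Q Set.univ, weight m b.1 b.2 := by
  classical
  choose r hr v hv h1 h2 h3 h4 h5 using exists_component hv hs
  have ht1 : ∀ i, Touches N Q (r i) (i + 1) := fun i =>
    ⟨r i, hr i, h1 i, h3 i, SimpleGraph.Reachable.refl _⟩
  have ht2 : ∀ i, Touches N Q (r i) (i + 2) := fun i => ⟨v i, hv i, h2 i, h4 i, h5 i⟩
  have hsub : ∀ (R : Set (Fin 3 → ℕ)), ∀ b ∈ cutEdges N Q R, b ∈ cutEdges N Q Set.univ :=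
    fun R b hb => mem_cutEdges.2
      ⟨(mem_cutEdges.1 hb).1, (mem_cutEdges.1 hb).2.1, Set.mem_univ _⟩
  by_cases hcon : ∃ i j, i ≠ j ∧ (cutGraph N Q).Reachable (r i) (r j)
  -- The component of corner i misses at most side i, and side i is touched by the component of any
  -- other corner.
  · obtain ⟨i, j, hij, hreach⟩ := hcon
    have htr : ∀ l, Touches N Q (r j) l → Touches N Q (r i) l := by
      rintro l ⟨u, hu, a, b, c⟩
      exact ⟨u, hu, a, b, hreach.trans c⟩
    refine (le_sum_of_touches_three hN (r := r i) fun l => ?_).trans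
      (sum_cutEdges_le m _ (hsub _))
    have hcases : ∀ i j l : Fin 3, i ≠ j → l = i + 1 ∨ l = i + 2 ∨ l = j + 1 ∨ l = j + 2 := by
      decide
    rcases hcases i j l hij with rfl | rfl | rfl | rfl
    · exact ht1 i
    · exact ht2 i
    · exact htr _ (ht1 j)
    · exact htr _ (ht2 j)
  · push Not at hcon
    have hle : ∀ i, 2 * (m : ℤ) ≤
        ∑ b ∈ cutEdges N Q {x | (cutGraph N Q).Reachable (r i) x}, weight m b.1 b.2 := fun i =>
      le_sum_of_touches_two hN (by fin_cases i <;> decide) (ht1 i) (ht2 i)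
    have hU := sum_cutEdges_le (N := N) (Q := Q) m
      (univ.biUnion fun i => cutEdges N Q {x | (cutGraph N Q).Reachable (r i) x}) (by
        intro b hb
        obtain ⟨i, -, hi⟩ := mem_biUnion.1 hb
        exact hsub _ b hi)
    rw [Finset.sum_biUnion fun i _ j _ hij => cutEdges_disjoint (hcon i j hij),
      Fin.sum_univ_three] at hU
    linarith [hle 0, hle 1, hle 2]

/-! ### Counting the total weight. -/

theorem card_tri_slice {s : ℕ} (i : Fin 3) {a : ℕ} (ha : a ≤ s) :
    ((tri s).filter fun u => u i = a).card = s + 1 - a := by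
  rw [← Finset.card_range (s + 1 - a)]
  symm
  refine Finset.card_bij
    (fun b _ => Pi.single i a + Pi.single (i + 1) b + Pi.single (i + 2) (s - a - b)) ?_ ?_ ?_
  · intro b hb
    rw [mem_range] at hb
    rw [mem_filter, mem_tri]
    fin_cases i <;> simp <;> omega
  · intro b _ c _ h
    have := congrFun h (i + 1)
    fin_cases i <;> simpa using this
  · intro u hu
    rw [mem_filter, mem_tri] at hu
    obtain ⟨h1, h2⟩ := hu
    refine ⟨u (i + 1), ?_, ?_⟩
    · rw [mem_range]
      fin_cases i <;> simp at h1 h2 ⊢ <;> omega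
    · funext j
      fin_cases i <;> fin_cases j <;> simp at h1 h2 ⊢ <;> omega

theorem card_tri_le {m N : ℕ} (hN : N + 2 = 3 * m) (i : Fin 3) :
    (((tri (N + 1)).filter fun u => u i ≤ 2 * m).card : ℤ) ≤ 4 * m ^ 2 + 2 * m := by
  have h1 : ((tri (N + 1)).filter fun u => u i ≤ 2 * m).card =
      ∑ a ∈ range (2 * m + 1), ((tri (N + 1)).filter fun u => u i = a).card := by
    rw [Finset.card_eq_sum_card_fiberwise (f := fun u => u i) (t := range (2 * m + 1))]
    · refine Finset.sum_congr rfl fun a ha => ?_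
      rw [Finset.filter_filter]
      congr 1
      ext u
      rw [mem_range] at ha
      simp only [mem_filter]
      constructor
      · rintro ⟨h, -, h'⟩; exact ⟨h, h'⟩
      · rintro ⟨h, h'⟩; exact ⟨h, by omega, h'⟩
    · intro u hu
      simp only [coe_filter, Set.mem_ofPred_eq] at hu
      simp only [coe_range, Set.mem_Iio]
      omega
  -- The slice at height a has 3m - a faces. Doubling avoids division, and the bound on k keeps the
  -- natural subtraction exact.
  have h2 : ∀ k : ℕ, k ≤ 3 * m → 2 * ∑ a ∈ range k,
      (((tri (N + 1)).filter fun u => u i = a).card : ℤ) = k * (6 * m + 1 - k) := by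
    intro k
    induction k with
    | zero => simp
    | succ k ih =>
      intro hk
      rw [Finset.sum_range_succ, mul_add, ih (by omega), card_tri_slice i (by omega)]
      have : ((N + 1 + 1 - k : ℕ) : ℤ) = 3 * m - k := by omega
      rw [this]
      push_cast
      ring
  have h3 : 0 < m := by omega
  have h4 := h2 (2 * m + 1) (by omega)
  rw [h1]
  push_cast at h4 ⊢
  nlinarith

theorem sum_range_sub_two_mul (m : ℕ) :
    2 * ∑ a ∈ range (3 * m), ((a - 2 * m : ℕ) : ℤ) = m * (m - 1) := by
  have h : ∀ k : ℕ, 2 * ∑ a ∈ range (2 * m + k), ((a - 2 * m : ℕ) : ℤ) = k * (k - 1) := by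
    intro k
    induction k with
    | zero =>
      simp only [add_zero, Nat.cast_zero, zero_mul, mul_eq_zero, OfNat.ofNat_ne_zero, false_or]
      refine Finset.sum_eq_zero fun a ha => ?_
      rw [mem_range] at ha
      omega
    | succ k ih =>
      rw [← add_assoc, Finset.sum_range_succ, mul_add, ih, Nat.add_sub_cancel_left]
      push_cast
      ring
  have := h m
  rwa [show 2 * m + m = 3 * m by ring] at this

/-- Each of the two corners on side i contributes m(m - 1)/2; a reflection of the side exchanges
them. -/
theorem sum_border {m N : ℕ} (hN : N + 2 = 3 * m) (i : Fin 3) :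
    ∑ u ∈ tri (N + 1) with u i = 0, (((u (i + 1) - 2 * m : ℕ) : ℤ) + ((u (i + 2) - 2 * m : ℕ) : ℤ))
      = m * (m - 1) := by
  have h := sum_side N (fun u => ((u (i + 1) - 2 * m : ℕ) : ℤ) + ((u (i + 2) - 2 * m : ℕ) : ℤ))
    (i + 2)
  have hi : i + 2 + 1 = i := by fin_cases i <;> rfl
  have hi' : i + 2 + 2 = i + 1 := by fin_cases i <;> rfl
  have hne : i + 1 ≠ i + 2 := by fin_cases i <;> decide
  rw [hi, hi'] at h
  rw [h, Finset.sum_add_distrib]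
  simp only [Pi.add_apply, Pi.single_eq_same, Pi.single_eq_of_ne hne, Pi.single_eq_of_ne hne.symm,
    zero_add, add_zero]
  have hrefl := Finset.sum_range_reflect (fun a => ((a - 2 * m : ℕ) : ℤ)) (N + 2)
  have hrefl' : ∑ a ∈ range (N + 2), ((N + 1 - a - 2 * m : ℕ) : ℤ) =
      ∑ a ∈ range (N + 2), ((a - 2 * m : ℕ) : ℤ) := by
    rw [← hrefl]
    rfl
  rw [hrefl', hN, ← sum_range_sub_two_mul]
  ring

/-- The total weight, in units of `ρ`. -/
theorem sum_weight_le {m N : ℕ} (hN : N + 2 = 3 * m) :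
    ∑ b ∈ tri (N + 1) ×ˢ univ, weight m b.1 b.2 ≤ 15 * m ^ 2 + 3 * m := by
  rw [Finset.sum_product_right]
  have h : ∀ i, ∑ u ∈ tri (N + 1), weight m u i ≤ 5 * m ^ 2 + m := by
    intro i
    have h1 : ∀ u : Fin 3 → ℕ, weight m u i = (if u i ≤ 2 * m then 1 else 0) +
        if u i = 0 then (((u (i + 1) - 2 * m : ℕ) : ℤ) + ((u (i + 2) - 2 * m : ℕ) : ℤ)) else 0 := by
      intro u
      unfold weight
      split_ifs <;> omega
    simp_rw [h1]
    rw [Finset.sum_add_distrib, Finset.sum_boole, ← Finset.sum_filter, sum_border hN]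
    have := card_tri_le hN i
    linarith
  rw [Fin.sum_univ_three]
  linarith [h 0, h 1, h 2]

/-! ### Transfer between integer points and the real grid. -/

/-- The point of `Δ_{3,N+2}` with integer coordinates `x`. -/
noncomputable def gridPoint {N : ℕ} {x : Fin 3 → ℕ} (hx : x ∈ tri (N + 2)) : Grid 3 (N + 2) :=
  ⟨fun i => (x i : ℝ) / ((N + 2 : ℕ) : ℝ), by
    have hpos : (0 : ℝ) < ((N + 2 : ℕ) : ℝ) := by positivity
    refine ⟨⟨fun i => by positivity, ?_⟩, fun i => ⟨x i, by simp⟩⟩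
    rw [← Finset.sum_div, div_eq_one_iff_eq hpos.ne', Fin.sum_univ_three]
    exact_mod_cast mem_tri.1 hx⟩

theorem gridPoint_apply {N : ℕ} {x : Fin 3 → ℕ} (hx : x ∈ tri (N + 2)) (i : Fin 3) :
    (gridPoint hx).1 i = (x i : ℝ) / ((N + 2 : ℕ) : ℝ) := rfl

theorem gridPoint_inj {N : ℕ} {x y : Fin 3 → ℕ} {hx : x ∈ tri (N + 2)} {hy : y ∈ tri (N + 2)}
    (h : gridPoint hx = gridPoint hy) : x = y := by
  funext i
  have hpos : (0 : ℝ) < ((N + 2 : ℕ) : ℝ) := by positivity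
  have := congrFun (congrArg Subtype.val h) i
  rw [gridPoint_apply, gridPoint_apply, div_left_inj' hpos.ne'] at this
  exact_mod_cast this

theorem exists_gridPoint {N : ℕ} (p : Grid 3 (N + 2)) :
    ∃ (x : Fin 3 → ℕ) (hx : x ∈ tri (N + 2)), p = gridPoint hx := by
  obtain ⟨p, ⟨hp0, hp1⟩, hp⟩ := p
  have hpos : (0 : ℝ) < ((N + 2 : ℕ) : ℝ) := by positivity
  have : ∀ i, ∃ k : ℕ, p i = (k : ℝ) / ((N + 2 : ℕ) : ℝ) := by
    intro i
    obtain ⟨k, hk⟩ := hp i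
    have h0 := hp0 i
    rw [hk, le_div_iff₀ hpos, zero_mul] at h0
    lift k to ℕ using (by exact_mod_cast h0)
    exact ⟨k, by simpa using hk⟩
  choose x hx using this
  refine ⟨x, ?_, ?_⟩
  · rw [mem_tri]
    simp_rw [hx] at hp1
    rw [← Finset.sum_div, div_eq_one_iff_eq hpos.ne', Fin.sum_univ_three] at hp1
    exact_mod_cast hp1
  · ext i
    exact hx i

theorem l1Dist_gridPoint {N : ℕ} {x y : Fin 3 → ℕ} (hx : x ∈ tri (N + 2)) (hy : y ∈ tri (N + 2)) :
    l1Dist (gridPoint hx).1 (gridPoint hy).1 =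
      ((∑ i, |(x i : ℤ) - y i| : ℤ) : ℝ) / ((N + 2 : ℕ) : ℝ) := by
  have hpos : (0 : ℝ) < ((N + 2 : ℕ) : ℝ) := by positivity
  unfold l1Dist
  push_cast
  rw [Finset.sum_div]
  refine Finset.sum_congr rfl fun i _ => ?_
  rw [gridPoint_apply, gridPoint_apply, ← sub_div, abs_div, abs_of_pos hpos]
  push_cast
  rfl

theorem gridGraph_adj_gridPoint {N : ℕ} {x y : Fin 3 → ℕ} (hx : x ∈ tri (N + 2))
    (hy : y ∈ tri (N + 2)) : (gridGraph 3 (N + 2)).Adj (gridPoint hx) (gridPoint hy) ↔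
      ∑ i, |(x i : ℤ) - y i| = 2 := by
  have hpos : (0 : ℝ) < ((N + 2 : ℕ) : ℝ) := by positivity
  constructor
  · rintro ⟨-, h⟩
    rw [l1Dist_gridPoint, div_left_inj' hpos.ne'] at h
    exact_mod_cast h
  · intro h
    refine ⟨fun h' => ?_, ?_⟩
    · rw [gridPoint_inj h'] at h
      simp at h
    · rw [l1Dist_gridPoint, div_left_inj' hpos.ne', h]
      norm_num

theorem gridGraph_adj_face {N : ℕ} {u : Fin 3 → ℕ} (hu : u ∈ tri (N + 1)) (i : Fin 3) :
    (gridGraph 3 (N + 2)).Adj (gridPoint (add_unit_mem_tri hu (i + 1)))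
      (gridPoint (add_unit_mem_tri hu (i + 2))) := by
  rw [gridGraph_adj_gridPoint, Fin.sum_univ_three]
  fin_cases i <;> simp [unit_apply]

/-- The edge of the up-face `u` in direction `i`. -/
noncomputable def faceEdge (N : ℕ) (b : tri (N + 1) × Fin 3) : GridEdge 3 (N + 2) :=
  ⟨s(gridPoint (add_unit_mem_tri b.1.2 (b.2 + 1)), gridPoint (add_unit_mem_tri b.1.2 (b.2 + 2))),
    gridGraph_adj_face b.1.2 b.2⟩

theorem faceEdge_injective (N : ℕ) : Function.Injective (faceEdge N) := by
  rintro ⟨⟨u, hu⟩, i⟩ ⟨⟨v, hv⟩, j⟩ h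
  have h' := congrArg Subtype.val h
  simp only [faceEdge, Sym2.eq_iff] at h'
  have key : u = v ∧ i = j := by
    rw [mem_tri] at hu hv
    rcases h' with ⟨h1, h2⟩ | ⟨h1, h2⟩
    all_goals
      have h1 := gridPoint_inj h1
      have h2 := gridPoint_inj h2
      have a0 := congrFun h1 0
      have a1 := congrFun h1 1
      have a2 := congrFun h1 2
      have b0 := congrFun h2 0
      have b1 := congrFun h2 1
      have b2 := congrFun h2 2
      clear h h1 h2
      have huv : (u 0 = v 0 ∧ u 1 = v 1 ∧ u 2 = v 2) ∧ i = j := by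
        fin_cases i <;> fin_cases j <;> simp [unit_apply] at a0 a1 a2 b0 b1 b2 ⊢ <;> omega
      refine ⟨?_, huv.2⟩
      funext l
      fin_cases l
      exacts [huv.1.1, huv.1.2.1, huv.1.2.2]
  obtain ⟨rfl, rfl⟩ := key
  rfl

theorem exists_face {N : ℕ} {x y : Fin 3 → ℕ} (hx : x ∈ tri (N + 2)) (hy : y ∈ tri (N + 2))
    (h : ∑ i, |(x i : ℤ) - y i| = 2) : ∃ u ∈ tri (N + 1), ∃ i : Fin 3,
      (x = u + unit (i + 1) ∧ y = u + unit (i + 2)) ∨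
        (y = u + unit (i + 1) ∧ x = u + unit (i + 2)) := by
  rw [mem_tri] at hx hy
  rw [Fin.sum_univ_three] at h
  have h0 := abs_cases ((x 0 : ℤ) - y 0)
  have h1 := abs_cases ((x 1 : ℤ) - y 1)
  have h2 := abs_cases ((x 2 : ℤ) - y 2)
  -- The up-face containing the edge is the coordinatewise minimum of its endpoints.
  refine ⟨fun l => min (x l) (y l), ?_, ?_⟩
  · rw [mem_tri]
    omega
  · have hcases : ∃ i : Fin 3, x i = y i ∧
        ((x (i + 1) = y (i + 1) + 1 ∧ y (i + 2) = x (i + 2) + 1) ∨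
          (y (i + 1) = x (i + 1) + 1 ∧ x (i + 2) = y (i + 2) + 1)) := by
      by_cases e0 : x 0 = y 0
      · exact ⟨0, e0, by simp only [zero_add]; omega⟩
      · by_cases e1 : x 1 = y 1
        · refine ⟨1, e1, ?_⟩
          change (x 2 = y 2 + 1 ∧ y 0 = x 0 + 1) ∨ (y 2 = x 2 + 1 ∧ x 0 = y 0 + 1)
          omega
        · refine ⟨2, by omega, ?_⟩
          change (x 0 = y 0 + 1 ∧ y 1 = x 1 + 1) ∨ (y 0 = x 0 + 1 ∧ x 1 = y 1 + 1)
          omega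
    clear h h0 h1 h2
    obtain ⟨i, hi, hc⟩ := hcases
    refine ⟨i, hc.imp (fun hc => ⟨?_, ?_⟩) (fun hc => ⟨?_, ?_⟩)⟩ <;>
    · obtain ⟨h1, h2⟩ := hc
      funext j
      fin_cases i <;> fin_cases j <;> simp [unit_apply] at hi h1 h2 ⊢ <;> omega

theorem faceEdge_bijective (N : ℕ) : Function.Bijective (faceEdge N) := by
  refine ⟨faceEdge_injective N, ?_⟩
  rintro ⟨e, he⟩
  induction e with
  | h p q =>
    obtain ⟨x, hx, rfl⟩ := exists_gridPoint p
    obtain ⟨y, hy, rfl⟩ := exists_gridPoint q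
    rw [SimpleGraph.mem_edgeSet, gridGraph_adj_gridPoint] at he
    obtain ⟨u, hu, i, ⟨rfl, rfl⟩ | ⟨rfl, rfl⟩⟩ := exists_face hx hy he
    · exact ⟨(⟨u, hu⟩, i), rfl⟩
    · refine ⟨(⟨u, hu⟩, i), Subtype.ext ?_⟩
      exact Sym2.eq_swap

theorem edgeLength_faceEdge {N : ℕ} (b : tri (N + 1) × Fin 3) :
    edgeLength (faceEdge N b).1 = 2 / ((N + 2 : ℕ) : ℝ) :=
  (gridGraph_adj_face b.1.2 b.2).2

section

variable {m N : ℕ} {x y : Fin 3 → ℕ} (hx : x ∈ tri (N + 2)) (hy : y ∈ tri (N + 2))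

theorem div_le_two_thirds_iff (hN : N + 2 = 3 * m) (a : ℕ) :
    (a : ℝ) / ((N + 2 : ℕ) : ℝ) ≤ 2 / 3 ↔ a ≤ 2 * m := by
  have hpos : (0 : ℝ) < ((N + 2 : ℕ) : ℝ) := by positivity
  rw [div_le_iff₀ hpos, hN, ← Nat.cast_le (α := ℝ)]
  push_cast
  constructor <;> intro h <;> linarith

theorem two_thirds_le_div_iff (hN : N + 2 = 3 * m) (a : ℕ) :
    2 / 3 ≤ (a : ℝ) / ((N + 2 : ℕ) : ℝ) ↔ 2 * m ≤ a := by
  have hpos : (0 : ℝ) < ((N + 2 : ℕ) : ℝ) := by positivity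
  rw [le_div_iff₀ hpos, hN, ← Nat.cast_le (α := ℝ)]
  push_cast
  constructor <;> intro h <;> linarith

theorem inHexagon_iff (hN : N + 2 = 3 * m) :
    InHexagon s(gridPoint hx, gridPoint hy) ↔ ∀ i, x i ≤ 2 * m ∧ y i ≤ 2 * m := by
  simp only [InHexagon, Sym2.mem_iff, forall_eq_or_imp, forall_eq, gridPoint_apply,
    div_le_two_thirds_iff hN]
  exact forall_and.symm

theorem inCorner_iff (hN : N + 2 = 3 * m) (l : Fin 3) :
    InCorner l s(gridPoint hx, gridPoint hy) ↔ 2 * m ≤ x l ∧ 2 * m ≤ y l := by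
  simp only [InCorner, Sym2.mem_iff, forall_eq_or_imp, forall_eq, gridPoint_apply,
    two_thirds_le_div_iff hN]

theorem onBorder_iff :
    OnBorder s(gridPoint hx, gridPoint hy) ↔ ∃ j, x j = 0 ∧ y j = 0 := by
  have hpos : ((N + 2 : ℕ) : ℝ) ≠ 0 := by positivity
  simp only [OnBorder, Sym2.mem_iff, forall_eq_or_imp, forall_eq, gridPoint_apply,
    div_eq_zero_iff, hpos, or_false, Nat.cast_eq_zero]

theorem parallelToOpposite_iff (l : Fin 3) :
    ParallelToOpposite l s(gridPoint hx, gridPoint hy) ↔ x l = y l := by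
  have hpos : ((N + 2 : ℕ) : ℝ) ≠ 0 := by positivity
  simp only [ParallelToOpposite, Sym2.mem_iff, forall_eq_or_imp, forall_eq, gridPoint_apply,
    div_left_inj' hpos, Nat.cast_inj, true_and, and_true]
  exact ⟨fun h => h.1, fun h => ⟨h, h.symm⟩⟩

theorem cornerWeight_eq (hN : N + 2 = 3 * m) (l : Fin 3) :
    cornerWeight (N + 2) l s(gridPoint hx, gridPoint hy) =
      (if ∃ j, x j = 0 ∧ y j = 0 then (((max (x l) (y l) : ℕ) : ℝ) - 2 * m)
        else if x l = y l then 0 else 1) * gapRho (N + 2) := by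
  have hpos : (0 : ℝ) < ((N + 2 : ℕ) : ℝ) := by positivity
  have hmax : maxCoord l s(gridPoint hx, gridPoint hy) =
      ((max (x l) (y l) : ℕ) : ℝ) / ((N + 2 : ℕ) : ℝ) := by
    simp only [maxCoord, Sym2.lift_mk, gridPoint_apply]
    rw [max_div_div_right hpos.le, Nat.cast_max]
  unfold cornerWeight
  simp only [onBorder_iff, parallelToOpposite_iff]
  split_ifs
  · rw [hmax, mul_sub, mul_one, mul_div_cancel₀ _ hpos.ne', hN]
    push_cast
    ring
  · ring
  · ring

end

/-- In the corner l no other coordinate exceeds 2m, so the symmetric border formula keeps a single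
excess. The pairs with u i > 2m are those parallel to the side opposite e^i. -/
theorem weight_eq_of_corner {m N : ℕ} (hN : N + 2 = 3 * m) {u : Fin 3 → ℕ} (hu : u ∈ tri (N + 1))
    (i l : Fin 3) (h1 : 2 * m ≤ (u + unit (i + 1)) l) (h2 : 2 * m ≤ (u + unit (i + 2)) l)
    (h3 : ¬ ∀ j, (u + unit (i + 1)) j ≤ 2 * m ∧ (u + unit (i + 2)) j ≤ 2 * m) :
    (weight m u i : ℤ) = if ∃ j, (u + unit (i + 1)) j = 0 ∧ (u + unit (i + 2)) j = 0 then
        ((max ((u + unit (i + 1)) l) ((u + unit (i + 2)) l) : ℕ) : ℤ) - 2 * m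
      else if (u + unit (i + 1)) l = (u + unit (i + 2)) l then 0 else 1 := by
  rw [mem_tri] at hu
  unfold weight
  fin_cases i <;> fin_cases l <;>
    simp [unit_apply, Fin.exists_fin_succ, Fin.forall_fin_succ] at h1 h2 h3 ⊢ <;>
    split_ifs <;> omega

theorem gapWeight_faceEdge {m N : ℕ} (hN : N + 2 = 3 * m) (b : tri (N + 1) × Fin 3) :
    gapWeight (N + 2) (faceEdge N b).1 = (weight m b.1.1 b.2 : ℝ) * gapRho (N + 2) := by
  obtain ⟨⟨u, hu⟩, i⟩ := b
  have hx := add_unit_mem_tri hu (i + 1)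
  have hy := add_unit_mem_tri hu (i + 2)
  change gapWeight (N + 2) s(gridPoint hx, gridPoint hy) = (weight m u i : ℝ) * gapRho (N + 2)
  have hc : ∀ l, 2 * m ≤ (u + unit (i + 1)) l ∧ 2 * m ≤ (u + unit (i + 2)) l →
      (¬ ∀ j, (u + unit (i + 1)) j ≤ 2 * m ∧ (u + unit (i + 2)) j ≤ 2 * m) →
      cornerWeight (N + 2) l s(gridPoint hx, gridPoint hy) =
        (weight m u i : ℝ) * gapRho (N + 2) := by
    intro l hl h3
    rw [cornerWeight_eq hx hy hN, weight_eq_of_corner hN hu i l hl.1 hl.2 h3]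
    push_cast
    rfl
  unfold gapWeight
  simp only [inHexagon_iff hx hy hN, inCorner_iff hx hy hN]
  split_ifs with h h0 h1
  · have : weight m u i = 1 := by
      rw [mem_tri] at hu
      have a0 := h 0
      have a1 := h 1
      have a2 := h 2
      unfold weight
      fin_cases i <;> simp [unit_apply] at a0 a1 a2 ⊢ <;> split_ifs <;> omega
    rw [this]; simp
  · exact hc 0 h0 h
  · exact hc 1 h1 h
  -- Some endpoint has a coordinate above 2m, and along an edge a coordinate changes by at most 1,
  -- so the whole edge lies in one corner.
  · refine hc 2 ?_ h
    rw [mem_tri] at hu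
    fin_cases i <;> simp [unit_apply, Fin.forall_fin_succ] at h h0 h1 ⊢ <;> omega

theorem sum_gridEdge {N : ℕ} (F : GridEdge 3 (N + 2) → ℝ) (G : (Fin 3 → ℕ) × Fin 3 → ℝ)
    (h : ∀ b, F (faceEdge N b) = G (b.1.1, b.2)) :
    ∑ e, F e = ∑ b ∈ tri (N + 1) ×ˢ univ, G b := by
  rw [← (faceEdge_bijective N).sum_comp F, Finset.sum_congr rfl fun b _ => h b,
    Fintype.sum_prod_type, Finset.sum_product]
  exact Finset.sum_coe_sort (tri (N + 1)) fun u => ∑ i, G (u, i)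

theorem gapWeight_nonneg {m N : ℕ} (hN : N + 2 = 3 * m) (e : GridEdge 3 (N + 2)) :
    0 ≤ gapWeight (N + 2) e.1 := by
  obtain ⟨b, rfl⟩ := (faceEdge_bijective N).2 e
  rw [gapWeight_faceEdge hN]
  have := weight_nonneg m b.1.1 b.2
  unfold gapRho
  positivity

/-! ### The LP value and the cut cost. -/

theorem canonicalLP_le {m N : ℕ} (hN : N + 2 = 3 * m) {w : GridEdge 3 (N + 2) → ℝ≥0}
    (hw : ∀ e, (w e : ℝ) = gapWeight (N + 2) e.1) :
    canonicalLP w ≤ 5 / 6 + 1 / 2 / ((N + 2 : ℕ) : ℝ) := by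
  have hm : (0 : ℝ) < m := by
    have : 0 < m := by omega
    exact_mod_cast this
  unfold canonicalLP
  rw [sum_gridEdge _
    (fun b => (weight m b.1 b.2 : ℝ) * (gapRho (N + 2) / ((N + 2 : ℕ) : ℝ))), ← Finset.sum_mul]
  · have h : ((∑ b ∈ tri (N + 1) ×ˢ univ, weight m b.1 b.2 : ℤ) : ℝ) ≤ 15 * m ^ 2 + 3 * m := by
      exact_mod_cast sum_weight_le hN
    push_cast at h
    have hrho : gapRho (N + 2) / ((N + 2 : ℕ) : ℝ) = 1 / (18 * m ^ 2) := by
      unfold gapRho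
      rw [hN]
      push_cast
      field_simp
      norm_num
    rw [hrho]
    calc _ ≤ (15 * (m : ℝ) ^ 2 + 3 * m) * (1 / (18 * m ^ 2)) := by gcongr
      _ = _ := by
        rw [hN]
        push_cast
        field_simp
        ring
  · intro b
    rw [hw, gapWeight_faceEdge hN, edgeLength_faceEdge]
    ring

/-- The labelling of integer points induced by a cut of `Δ_{3,N+2}`. -/
noncomputable def labelling {N : ℕ} (P : Grid 3 (N + 2) → Fin 4) (x : Fin 3 → ℕ) : Fin 4 :=
  -- The value 0 off the grid is irrelevant: corners of up-faces in `tri (N + 1)` are grid points.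
  if hx : x ∈ tri (N + 2) then P (gridPoint hx) else 0

theorem labelling_eq {N : ℕ} (P : Grid 3 (N + 2) → Fin 4) {x : Fin 3 → ℕ} (hx : x ∈ tri (N + 2)) :
    labelling P x = P (gridPoint hx) := dif_pos hx

theorem isCutBy_faceEdge {N : ℕ} (P : Grid 3 (N + 2) → Fin 4) (b : tri (N + 1) × Fin 3) :
    IsCutBy P (faceEdge N b).1 ↔ EdgeCut (labelling P) b.1.1 b.2 := by
  unfold EdgeCut
  rw [labelling_eq P (add_unit_mem_tri b.1.2 _), labelling_eq P (add_unit_mem_tri b.1.2 _)]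
  simp only [IsCutBy, faceEdge, Sym2.mem_iff, exists_eq_or_imp, exists_eq_left, ne_eq,
    not_true_eq_false, false_or, or_false]
  rw [@eq_comm _ (P (gridPoint (add_unit_mem_tri b.1.2 (b.2 + 2)))), or_self]

theorem one_le_cutCost {m N : ℕ} (hN : N + 2 = 3 * m) {w : GridEdge 3 (N + 2) → ℝ≥0}
    (hw : ∀ e, (w e : ℝ) = gapWeight (N + 2) e.1) {P : Grid 3 (N + 2) → Fin (3 + 1)}
    (hP : IsNonOppositeCut P) : 1 ≤ cutCost P w := by
  classical
  have hm : (0 : ℝ) < m := by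
    have : 0 < m := by omega
    exact_mod_cast this
  have hpos : (0 : ℝ) < ((N + 2 : ℕ) : ℝ) := by positivity
  have hv : ∀ i : Fin 3, labelling P (Pi.single i (N + 2)) = i.castSucc := by
    intro i
    have hmem : Pi.single i (N + 2) ∈ tri (N + 2) := by
      rw [mem_tri]
      fin_cases i <;> simp
    rw [labelling_eq P hmem]
    apply hP.vertex
    funext j
    rw [gridPoint_apply]
    by_cases h : j = i
    · subst h
      simp only [Pi.single_eq_same]
      exact div_self hpos.ne'
    · simp [Pi.single_eq_of_ne h]
  have hs : ∀ (i : Fin 3) (x), x ∈ tri (N + 2) → x i = 0 → labelling P x ≠ i.castSucc := by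
    intro i x hx hi h
    rw [labelling_eq P hx] at h
    rcases hP.support (gridPoint hx) with ⟨j, hj, hj'⟩ | h'
    · have : i = j := Fin.castSucc_injective _ (h.symm.trans hj')
      subst this
      apply hj
      simp [gridPoint_apply, hi]
    · exact Fin.castSucc_ne_last i (h.symm.trans h')
  have hmain := le_sum_cutEdges hN hv hs
  have hmain' : 6 * (m : ℝ) ≤
      ((∑ b ∈ cutEdges N (labelling P) Set.univ, weight m b.1 b.2 : ℤ) : ℝ) := by
    exact_mod_cast hmain
  unfold cutCost
  rw [sum_gridEdge _
    (fun b => if EdgeCut (labelling P) b.1 b.2 then (weight m b.1 b.2 : ℝ) * gapRho (N + 2) else 0),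
    ← Finset.sum_filter, ← Finset.sum_mul]
  · have hset : cutEdges N (labelling P) Set.univ =
        (tri (N + 1) ×ˢ univ).filter fun b => EdgeCut (labelling P) b.1 b.2 := by
      ext b
      simp [mem_cutEdges]
    rw [hset] at hmain'
    push_cast at hmain'
    have hrho : gapRho (N + 2) = 1 / (6 * m) := by
      unfold gapRho
      rw [hN]
      push_cast
      ring
    rw [hrho, mul_one_div, one_le_div (by positivity)]
    exact hmain'
  · intro b
    rw [hw, gapWeight_faceEdge hN]
    exact if_congr (isCutBy_faceEdge P b) rfl rfl

end TriGrid

theorem mainTheorem3 :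
    ∃ C : ℝ, ∀ n : ℕ, 0 < n → 3 ∣ n →
      ∃ w : GridEdge 3 n → ℝ≥0,
        (∀ e : GridEdge 3 n, (w e : ℝ) = gapWeight n e.1) ∧
        canonicalLP w ≤ 5 / 6 + C / (n : ℝ) ∧
        ∀ P : Grid 3 n → Fin (3 + 1), IsNonOppositeCut P → 1 ≤ cutCost P w := by
  -- The excess 3m in the total weight, times ρ/n = 1/(18m²), is 1/(6m) = (1/2)/n.
  refine ⟨1 / 2, ?_⟩
  rintro n hn ⟨m, hm⟩
  obtain ⟨N, rfl⟩ : ∃ N, n = N + 2 := ⟨n - 2, by omega⟩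
  have hw : ∀ e : GridEdge 3 (N + 2),
      (((gapWeight (N + 2) e.1).toNNReal : ℝ≥0) : ℝ) = gapWeight (N + 2) e.1 := fun e =>
    Real.coe_toNNReal _ (TriGrid.gapWeight_nonneg hm e)
  exact ⟨fun e => (gapWeight (N + 2) e.1).toNNReal, hw, TriGrid.canonicalLP_le hm hw,
    fun P hP => TriGrid.one_le_cutCost hm hw hP⟩
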